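/- **Setting.** Let $\rho_1,\dots,\rho_k\in\mathbb{Q}$ be the values of a finite domain of size $k$ (repetitions are allowed), let $D(x)=(x-\rho_1)\cdots(x-\rho_k)$, and let $f_1,\dots,f_m\in\mathbb{R}[x_1,\dots,x_n]$. Consider the polynomial system over this domain $$\mathcal{P}=\{f_1=0,\dots,f_m=0\}\cup\{D(x_j)=0 : j\in[n]\}.$$ A *PC derivation* of "$r=0$" from $\mathcal{P}$ is a finite sequence of polynomials with rational coefficients, with last member $r$, each of which is some $f_i$, or some domain polynomial $D(x_j)$, or $a f+b g$ with $a,b\in\mathbb{R}$ and $f,g$ earlier members, or $x_j f$ with $f$ an earlier member. Its *degree* is the maximum degree of its members. Its *size* is the sum of the lengths of the binary encodings of its members, where a polynomial is encoded as the list of its nonzero terms, rational coefficients are reduced fractions in binary, and a monomial is the list of its variables with their exponents in binary. An *SoS proof* of "$q\ge 0$" from $\mathcal{P}=\{p_1=0,\dots,p_M=0\}$ is an identity $q=\sum_{i=1}^{t}s_i^2+\sum_{i=1}^{M}h_ip_i$ with $s_i,h_i\in\mathbb{R}[x_1,\dots,x_n]$. It has degree at most $e$ if $\deg(s_i^2)\le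 e$ and $\deg(h_ip_i)\le e$ for all $i$; its *coefficients are bounded by $B$* if every coefficient of every $s_i$ and $h_i$ has absolute value at most $B$. Let $\beta$ be the maximum number of bits of a value $\rho_i$ or of a non-leading coefficient of $D$, and write $\lg^+\frac1\varepsilon=\max\{0,\log_2\frac1\varepsilon\}$. **Theorem.** There are an absolute constant $c\in\mathbb{N}$ and fixed polynomials $P$ (in three variables) and $Q$ (in four variables) such that the following holds for all $n,m,k$, all $\rho_i$ and $f_i$ as above, every polynomial $r$, and every PC derivation of "$r=0$" from $\mathcal{P}$, of degree $d$ and size $S$. 1. If all the domain polynomials $D(x_1),\dots,D(x_n)$ occur in the derivation, then for every $\varepsilon>0$ there are SoS proofs of "$r+\varepsilon\ge0$" and of "$-r+\varepsilon\ge 0$" from $\mathcal{P}$ of degree at most $c(d+k)$ with coefficients bounded by $2^{P(k,\,S,\,\lg^+\frac1\varepsilon)}$. 2. Without this condition on the derivation, for every $\varepsilon>0$ there are SoS proofs of "$r+\varepsilon\ge0$" and of "$-r+\varepsilon\ge 0$" from $\mathcal{P}$ of degree at most $c(d+k)$ with coefficients bounded by $2^{Q(k,\,\beta,\,S,\,\lg^+\frac1\varepsilon)}$.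 -/

import Mathlib

noncomputable section

namespace SoSPC

open MvPolynomial

/-! ### Binary encodings -/

/-- Bit length of a rational number written as a reduced fraction in binary:
a sign bit, the numerator and the denominator. -/
def ratBits (q : ℚ) : ℕ :=
  1 + Nat.size q.num.natAbs + Nat.size q.den

/-- Bit length of a monomial, written as the list of the indices of the variables that occur in it,
each with its (nonzero) exponent, all in binary. -/
def monomialBits {n : ℕ} (α : Fin n →₀ ℕ) : ℕ :=
  ∑ j ∈ α.support, (Nat.size (j.val + 1) + Nat.size (α j))

/-- Bit length of a polynomial with rational coefficients, written as the list of its terms with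
nonzero coefficient; the summand `1` makes every polynomial, also `0`, have positive length. -/
def polyBits {n : ℕ} (p : MvPolynomial (Fin n) ℚ) : ℕ :=
  1 + ∑ α ∈ p.support, (ratBits (coeff α p) + monomialBits α)

/-! ### Polynomial systems over a finite domain -/

/-- A polynomial with rational coefficients, seen as a real polynomial. -/
abbrev toReal {n : ℕ} (p : MvPolynomial (Fin n) ℚ) : MvPolynomial (Fin n) ℝ :=
  map (algebraMap ℚ ℝ) p

/-- The domain polynomial `(x_j - ρ_1) ⋯ (x_j - ρ_k)`. The values `ρ_i` may repeat. -/
def domainPoly {n k : ℕ} (ρ : Fin k → ℚ) (j : Fin n) : MvPolynomial (Fin n) ℚ :=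
  ∏ i, (X j - C (ρ i))

/-- The system `F ∪ {D(x_j) = 0 | j ∈ [n]}`. -/
def system {n m k : ℕ} (F : Fin m → MvPolynomial (Fin n) ℝ) (ρ : Fin k → ℚ) :
    Fin m ⊕ Fin n → MvPolynomial (Fin n) ℝ :=
  Sum.elim F (fun j => toReal (domainPoly ρ j))

/-- The number of bits with which each of the values `ρ_i`, and each of the coefficients of the
univariate polynomial `(x - ρ_1) ⋯ (x - ρ_k)`, can be written. -/
def domainBits {k : ℕ} (ρ : Fin k → ℚ) : ℕ :=
  max (Finset.univ.sup fun i => ratBits (ρ i))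
    ((Finset.range k).sup fun l =>
      ratBits ((∏ i, (Polynomial.X - Polynomial.C (ρ i)) : Polynomial ℚ).coeff l))

/-! ### Polynomial calculus over a finite domain -/

/-- A PC derivation `(r_0, …, r_L)` of `r = 0` from the axioms `F` and the domain polynomials.
The lines have rational coefficients, as they are measured by their binary encodings; the axioms
and the scalars of the linear combination rule are real. -/
structure PCDerivation {n m k : ℕ} (F : Fin m → MvPolynomial (Fin n) ℝ) (ρ : Fin k → ℚ)
    (r : MvPolynomial (Fin n) ℝ) where
  /-- index of the last line -/
  last : ℕ
  /-- the lines -/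
  line : Fin (last + 1) → MvPolynomial (Fin n) ℚ
  step : ∀ i,
    (∃ l, toReal (line i) = F l) ∨
    (∃ j, line i = domainPoly ρ j) ∨
    (∃ i₁ < i, ∃ i₂ < i, ∃ a b : ℝ,
      toReal (line i) = C a * toReal (line i₁) + C b * toReal (line i₂)) ∨
    (∃ i₁ < i, ∃ j, line i = X j * line i₁)
  line_last : toReal (line (Fin.last last)) = r

namespace PCDerivation

variable {n m k : ℕ} {F : Fin m → MvPolynomial (Fin n) ℝ} {ρ : Fin k → ℚ}
  {r : MvPolynomial (Fin n) ℝ}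

/-- The degree of a derivation: the maximum degree of its lines. -/
def degree (π : PCDerivation F ρ r) : ℕ :=
  Finset.univ.sup fun i => (π.line i).totalDegree

/-- The size of a derivation: the sum of the lengths of the binary encodings of its lines. -/
def size (π : PCDerivation F ρ r) : ℕ :=
  ∑ i, polyBits (π.line i)

/-- The derivation derives every domain polynomial. -/
def DerivesDomain (π : PCDerivation F ρ r) : Prop :=
  ∀ j : Fin n, ∃ i, π.line i = domainPoly ρ j

end PCDerivation

/-! ### Sum-of-squares proofs -/

/-- An SoS proof `r = ∑ s_i² + ∑ h_i p_i` of `r ≥ 0` from the equations `p_i = 0`. -/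
structure SoSProof {n : ℕ} {ι : Type} [Fintype ι] (p : ι → MvPolynomial (Fin n) ℝ)
    (r : MvPolynomial (Fin n) ℝ) where
  /-- number of squares -/
  t : ℕ
  s : Fin t → MvPolynomial (Fin n) ℝ
  h : ι → MvPolynomial (Fin n) ℝ
  identity : r = ∑ i, s i ^ 2 + ∑ i, h i * p i

namespace SoSProof

variable {n : ℕ} {ι : Type} [Fintype ι] {p : ι → MvPolynomial (Fin n) ℝ}
  {r : MvPolynomial (Fin n) ℝ}

/-- The proof has degree at most `d`. -/
def DegreeLE (w : SoSProof p r) (d : ℕ) : Prop :=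
  (∀ i, (w.s i ^ 2).totalDegree ≤ d) ∧ ∀ i, (w.h i * p i).totalDegree ≤ d

/-- All coefficients of the polynomials `s_i`, `h_i` have absolute value at most `B`. -/
def CoeffLE (w : SoSProof p r) (B : ℝ) : Prop :=
  (∀ i α, |coeff α (w.s i)| ≤ B) ∧ ∀ i α, |coeff α (w.h i)| ≤ B

end SoSProof

/-- There is an SoS proof of `r ≥ 0` from `p` of degree at most `d` with coefficients bounded
by `B`. -/
def HasSoSProof {n : ℕ} {ι : Type} [Fintype ι] (p : ι → MvPolynomial (Fin n) ℝ)
    (r : MvPolynomial (Fin n) ℝ) (d : ℕ) (B : ℝ) : Prop :=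
  ∃ w : SoSProof p r, w.DegreeLE d ∧ w.CoeffLE B

/-- `lg (1/ε)`, read as `0` when `ε ≥ 1`. -/
def lgInv (ε : ℝ) : ℝ :=
  max 0 (Real.logb 2 (1 / ε))

end SoSPC

end

/-! The induction along the derivation carries the statement "$-f^2\ge 0$" for each line $f$, rather
than "$f\ge 0$" and "$-f\ge 0$". It passes through the rules without accumulating degree: an axiom
$f$ is its own cofactor, $-f^2=(-f)f$; $-(af+bg)^2=2a^2(-f^2)+2b^2(-g^2)+(af-bg)^2$;
$-(x_jf)^2=M(-f^2)+(M-x_j^2)f^2$, where $M-x_j^2$ is a sum of squares modulo $D(x_j)$. At the end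
$r+\varepsilon$ is recovered by completing a square (`add_C_of_neg_sq`). Each rule multiplies the
coefficient bound by at most one fixed factor $2^{\mathrm{poly}}$, and there are at most $S$ lines,
so the exponent stays polynomial.

Two points need care. The real scalars $a,b$ of a linear combination are not controlled by the size;
Cramer's rule replaces them by scalars of size $2^{O(S)}$ (`exists_small_linear_combination`). And
the certificate of $M-x^2$ must have bounds independent of the distances between the $\rho_i$, which
may coincide, so interpolation is unsuitable. It is built by adding one linear factor at a time
(`exists_const_sub_sq_eq_sum_sq_add`), in a weighted norm that division by $X-\rho_i$ does not
increase.

The two parts of the theorem differ only in the bound on $|\rho_i|$: Cauchy's root bound applied to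
a line $D(x_j)$, or $\beta$. -/

noncomputable section

namespace SoSPC

open MvPolynomial

/-! ### The `ℓ¹` norm of a multivariate polynomial -/

/-- The sum of the absolute values of the coefficients. -/
def l1 {σ : Type*} (p : MvPolynomial σ ℝ) : ℝ := ∑ α ∈ p.support, |coeff α p|

section l1

variable {σ ι : Type*}

lemma l1_eq_sum_of_support_subset (p : MvPolynomial σ ℝ) {s : Finset (σ →₀ ℕ)}
    (h : p.support ⊆ s) : l1 p = ∑ α ∈ s, |coeff α p| := by
  refine Finset.sum_subset h fun α _ hα => ?_
  rw [notMem_support_iff.1 hα, abs_zero]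

lemma l1_nonneg (p : MvPolynomial σ ℝ) : 0 ≤ l1 p :=
  Finset.sum_nonneg fun _ _ => abs_nonneg _

lemma abs_coeff_le_l1 (p : MvPolynomial σ ℝ) (α : σ →₀ ℕ) : |coeff α p| ≤ l1 p := by
  by_cases h : α ∈ p.support
  · exact Finset.single_le_sum (f := fun α => |coeff α p|) (fun _ _ => abs_nonneg _) h
  · rw [notMem_support_iff.1 h, abs_zero]
    exact l1_nonneg p

lemma l1_add_le (p q : MvPolynomial σ ℝ) : l1 (p + q) ≤ l1 p + l1 q := by
  classical
  rw [l1_eq_sum_of_support_subset (p + q) (support_add (p := p) (q := q)),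
    l1_eq_sum_of_support_subset p (Finset.subset_union_left (s₂ := q.support)),
    l1_eq_sum_of_support_subset q (Finset.subset_union_right (s₁ := p.support)),
    ← Finset.sum_add_distrib]
  exact Finset.sum_le_sum fun α _ => by rw [coeff_add]; exact abs_add_le _ _

lemma l1_zero : l1 (0 : MvPolynomial σ ℝ) = 0 := by simp [l1]

lemma l1_neg (p : MvPolynomial σ ℝ) : l1 (-p) = l1 p := by
  simp [l1, support_neg]

lemma l1_sum_le (s : Finset ι) (f : ι → MvPolynomial σ ℝ) :
    l1 (∑ i ∈ s, f i) ≤ ∑ i ∈ s, l1 (f i) :=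
  Finset.le_sum_of_subadditive l1 l1_zero.le l1_add_le s f

lemma l1_monomial (α : σ →₀ ℕ) (a : ℝ) : l1 (monomial α a) = |a| := by
  classical
  rw [l1_eq_sum_of_support_subset _ support_monomial_subset]
  simp

lemma l1_C (a : ℝ) : l1 (C a : MvPolynomial σ ℝ) = |a| := l1_monomial 0 a

lemma l1_mul_le (p q : MvPolynomial σ ℝ) : l1 (p * q) ≤ l1 p * l1 q := by
  conv_lhs => rw [p.as_sum, q.as_sum, Finset.sum_mul_sum]
  refine (l1_sum_le _ _).trans ?_
  rw [l1, l1, Finset.sum_mul_sum]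
  refine Finset.sum_le_sum fun α _ => (l1_sum_le _ _).trans (Finset.sum_le_sum fun β _ => ?_)
  rw [monomial_mul, l1_monomial, abs_mul]

lemma l1_C_mul_le (a : ℝ) (p : MvPolynomial σ ℝ) : l1 (C a * p) ≤ |a| * l1 p :=
  (l1_mul_le _ _).trans_eq (by rw [l1_C])

lemma l1_sq_le (p : MvPolynomial σ ℝ) : l1 (p ^ 2) ≤ l1 p ^ 2 := by
  rw [sq, sq]; exact l1_mul_le p p

lemma l1_X_pow (j : σ) (i : ℕ) : l1 (X j ^ i : MvPolynomial σ ℝ) = 1 := by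
  rw [X_pow_eq_monomial, l1_monomial, abs_one]

end l1

/-! ### A weighted `ℓ¹` norm of a univariate polynomial -/

/-- The weighted norm `∑ |a_i| W ^ i` of the polynomial `∑ a_i X ^ i`. -/
def wnorm (W : ℝ) (p : Polynomial ℝ) : ℝ := ∑ i ∈ p.support, |p.coeff i| * W ^ i

section wnorm

variable {ι : Type*} {W : ℝ}

lemma wnorm_eq_sum_of_support_subset (p : Polynomial ℝ) {s : Finset ℕ}
    (h : p.support ⊆ s) : wnorm W p = ∑ i ∈ s, |p.coeff i| * W ^ i := by
  refine Finset.sum_subset h fun i _ hi => ?_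
  rw [Polynomial.notMem_support_iff.1 hi, abs_zero, zero_mul]

lemma wnorm_nonneg (hW : 0 ≤ W) (p : Polynomial ℝ) : 0 ≤ wnorm W p :=
  Finset.sum_nonneg fun _ _ => by positivity

lemma wnorm_add_le (hW : 0 ≤ W) (p q : Polynomial ℝ) :
    wnorm W (p + q) ≤ wnorm W p + wnorm W q := by
  rw [wnorm_eq_sum_of_support_subset (p + q) Polynomial.support_add,
    wnorm_eq_sum_of_support_subset p (Finset.subset_union_left (s₂ := q.support)),
    wnorm_eq_sum_of_support_subset q (Finset.subset_union_right (s₁ := p.support)),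
    ← Finset.sum_add_distrib]
  refine Finset.sum_le_sum fun i _ => ?_
  rw [Polynomial.coeff_add, ← add_mul]
  exact mul_le_mul_of_nonneg_right (abs_add_le _ _) (by positivity)

lemma wnorm_zero : wnorm W 0 = 0 := by simp [wnorm]

lemma wnorm_sum_le (hW : 0 ≤ W) (s : Finset ι) (f : ι → Polynomial ℝ) :
    wnorm W (∑ i ∈ s, f i) ≤ ∑ i ∈ s, wnorm W (f i) :=
  Finset.le_sum_of_subadditive (wnorm W) wnorm_zero.le (wnorm_add_le hW) s f

lemma wnorm_monomial (i : ℕ) (a : ℝ) : wnorm W (Polynomial.monomial i a) = |a| * W ^ i := by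
  rw [wnorm_eq_sum_of_support_subset _ (Polynomial.support_monomial_subset i a)]
  simp

lemma wnorm_C (a : ℝ) : wnorm W (Polynomial.C a) = |a| := by
  simpa using wnorm_monomial (W := W) 0 a

lemma wnorm_X : wnorm W Polynomial.X = W := by
  rw [← Polynomial.monomial_one_one_eq_X, wnorm_monomial, abs_one, one_mul, pow_one]

lemma wnorm_mul_le (hW : 0 ≤ W) (p q : Polynomial ℝ) :
    wnorm W (p * q) ≤ wnorm W p * wnorm W q := by
  conv_lhs => rw [p.as_sum_support, q.as_sum_support, Finset.sum_mul_sum]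
  refine (wnorm_sum_le hW _ _).trans ?_
  rw [wnorm, wnorm, Finset.sum_mul_sum]
  refine Finset.sum_le_sum fun i _ =>
    (wnorm_sum_le hW _ _).trans (Finset.sum_le_sum fun j _ => ?_)
  rw [Polynomial.monomial_mul_monomial, wnorm_monomial, abs_mul, pow_add]
  exact le_of_eq (by ring)

lemma wnorm_C_mul_le (hW : 0 ≤ W) (a : ℝ) (p : Polynomial ℝ) :
    wnorm W (Polynomial.C a * p) ≤ |a| * wnorm W p :=
  (wnorm_mul_le hW _ _).trans_eq (by rw [wnorm_C])

lemma abs_eval_le_wnorm {x : ℝ} (hx : |x| ≤ W) (p : Polynomial ℝ) :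
    |p.eval x| ≤ wnorm W p := by
  rw [Polynomial.eval_eq_sum, Polynomial.sum]
  refine (Finset.abs_sum_le_sum_abs _ _).trans (Finset.sum_le_sum fun i _ => ?_)
  rw [abs_mul, abs_pow]
  gcongr

/-- Substituting a variable does not increase the norm, when `1 ≤ W`. -/
lemma l1_aeval_X_le {σ : Type*} (hW : 1 ≤ W) (j : σ) (p : Polynomial ℝ) :
    l1 (Polynomial.aeval (X j : MvPolynomial σ ℝ) p) ≤ wnorm W p := by
  rw [Polynomial.aeval_eq_sum_range' (Nat.lt_succ_self p.natDegree),
    wnorm_eq_sum_of_support_subset p Polynomial.supp_subset_range_natDegree_succ]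
  refine (l1_sum_le _ _).trans (Finset.sum_le_sum fun i _ => ?_)
  rw [smul_eq_C_mul]
  refine (l1_C_mul_le _ _).trans ?_
  rw [l1_X_pow]
  exact mul_le_mul_of_nonneg_left (one_le_pow₀ hW) (abs_nonneg _)

/-- The polynomial is $(X^i-x^i)/(X-x)$. Its norm is at most $(W^i-|x|^i)/(W-|x|)$, and the
denominator is at least $1$. -/
lemma wnorm_geom_le {x : ℝ} (hx : |x| + 1 ≤ W) (i : ℕ) :
    wnorm W (∑ j ∈ Finset.range i, Polynomial.X ^ j * Polynomial.C x ^ (i - 1 - j)) ≤ W ^ i := by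
  have hx0 := abs_nonneg x
  have hW : 0 ≤ W := by linarith
  have h : wnorm W (∑ j ∈ Finset.range i, Polynomial.X ^ j * Polynomial.C x ^ (i - 1 - j)) ≤
      ∑ j ∈ Finset.range i, W ^ j * |x| ^ (i - 1 - j) := by
    refine (wnorm_sum_le hW _ _).trans (Finset.sum_le_sum fun j _ => ?_)
    rw [← Polynomial.C_pow, mul_comm, Polynomial.C_mul_X_pow_eq_monomial, wnorm_monomial, abs_pow,
      mul_comm]
  refine h.trans ?_
  have hg := geom_sum₂_mul W |x| i
  have hs : 0 ≤ ∑ j ∈ Finset.range i, W ^ j * |x| ^ (i - 1 - j) :=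
    Finset.sum_nonneg fun _ _ => by positivity
  have : 0 ≤ |x| ^ i := by positivity
  nlinarith

/-- Division by `X - x` does not increase the weighted norm, when `|x| + 1 ≤ W`. -/
lemma exists_eq_C_eval_add_X_sub_C_mul {x : ℝ} (hx : |x| + 1 ≤ W) (p : Polynomial ℝ) :
    ∃ q : Polynomial ℝ, p = Polynomial.C (p.eval x) + (Polynomial.X - Polynomial.C x) * q ∧
      wnorm W q ≤ wnorm W p ∧ q.natDegree ≤ p.natDegree := by
  have hW : 0 ≤ W := by linarith [abs_nonneg x]
  refine ⟨∑ i ∈ p.support, Polynomial.C (p.coeff i) *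
    ∑ j ∈ Finset.range i, Polynomial.X ^ j * Polynomial.C x ^ (i - 1 - j), ?_, ?_, ?_⟩
  · rw [Finset.mul_sum]
    conv_lhs => rw [p.as_sum_support_C_mul_X_pow]
    rw [Polynomial.eval_eq_sum, Polynomial.sum, map_sum, ← Finset.sum_add_distrib]
    refine Finset.sum_congr rfl fun i _ => ?_
    have := geom_sum₂_mul (Polynomial.X : Polynomial ℝ) (Polynomial.C x) i
    rw [Polynomial.C_mul, Polynomial.C_pow]
    linear_combination (-Polynomial.C (p.coeff i)) * this
  · refine (wnorm_sum_le hW _ _).trans (Finset.sum_le_sum fun i _ => ?_)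
    refine (wnorm_C_mul_le hW _ _).trans ?_
    exact mul_le_mul_of_nonneg_left (wnorm_geom_le hx i) (abs_nonneg _)
  · refine Polynomial.natDegree_sum_le_of_forall_le _ _ fun i hi => ?_
    refine (Polynomial.natDegree_C_mul_le _ _).trans ?_
    refine Polynomial.natDegree_sum_le_of_forall_le _ _ fun j hj => ?_
    rw [← Polynomial.C_pow]
    refine (Polynomial.natDegree_mul_C_le _ _).trans ?_
    rw [Polynomial.natDegree_X_pow]
    exact (Finset.mem_range.1 hj).le.trans (Polynomial.le_natDegree_of_mem_supp i hi)

end wnorm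

/-! ### Positivity over the roots of a real-rooted polynomial -/

lemma natDegree_prod_X_sub_C_fin {k : ℕ} (ρ : Fin k → ℝ) :
    (∏ i, (Polynomial.X - Polynomial.C (ρ i))).natDegree = k := by
  rw [Polynomial.natDegree_prod_of_monic _ _ fun i _ => Polynomial.monic_X_sub_C _]
  simp

lemma wnorm_prod_X_sub_C_le {W : ℝ} {k : ℕ} (ρ : Fin k → ℝ) (hW : 0 ≤ W)
    (hρ : ∀ i, |ρ i| ≤ W) :
    wnorm W (∏ i, (Polynomial.X - Polynomial.C (ρ i))) ≤ (2 * W) ^ k := by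
  induction k with
  | zero => simpa using (wnorm_C (W := W) 1).le
  | succ k ih =>
    rw [Fin.prod_univ_succ, pow_succ']
    refine (wnorm_mul_le hW _ _).trans ?_
    have h : wnorm W (Polynomial.X - Polynomial.C (ρ 0)) ≤ 2 * W := by
      rw [sub_eq_add_neg, ← Polynomial.C_neg]
      refine (wnorm_add_le hW _ _).trans ?_
      rw [wnorm_X, wnorm_C, abs_neg]
      linarith [hρ 0]
    exact mul_le_mul h (ih _ fun i => hρ _) (wnorm_nonneg hW _) (by positivity)

/-- A quadratic equation with a small solution. -/
lemma exists_small_root (c e : ℝ) :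
    ∃ u v : ℝ, u ^ 2 = 1 + |e * c| + c ^ 2 ∧ 2 * u * v + v ^ 2 * e = c ∧ |v| ≤ 1 ∧ 0 ≤ u := by
  -- This choice gives $u\ge|c|$ and makes $u^2+ec$, a quarter of the discriminant of $ev^2+2uv-c$,
  -- positive.
  set u := √(1 + |e * c| + c ^ 2)
  have hec := neg_abs_le (e * c)
  have hec0 := abs_nonneg (e * c)
  have hu2 : u ^ 2 = 1 + |e * c| + c ^ 2 := Real.sq_sqrt (by positivity)
  have hu0 : 0 ≤ u := Real.sqrt_nonneg _
  have hcu : |c| ≤ u := by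
    refine abs_le_of_sq_le_sq ?_ hu0
    nlinarith
  have hu : 0 < u := by
    rcases hu0.eq_or_lt with h | h
    · rw [← h] at hu2
      nlinarith [sq_nonneg c]
    · exact h
  set t := √(u ^ 2 + e * c)
  have ht0 : 0 ≤ t := Real.sqrt_nonneg _
  have ht : t ^ 2 = u ^ 2 + e * c := Real.sq_sqrt (by nlinarith [sq_nonneg c])
  -- The root $(-u+t)/e$ in rationalised form, since $e$ may be $0$ or tiny.
  refine ⟨u, c / (u + t), hu2, ?_, ?_, hu0⟩
  · have hne : u + t ≠ 0 := by positivity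
    field_simp
    linear_combination (-c) * ht
  · rw [abs_div, abs_of_pos (by positivity : 0 < u + t), div_le_one (by positivity)]
    linarith

/-- Bookkeeping for the next induction: $k$ old contributions and one new one, all raised to the new
bound $z$. -/
lemma add_le_succ_mul {A B c y z : ℝ} {k : ℕ} (hA : A ≤ k * (c * y)) (hB : B ≤ c * y)
    (hc : 0 ≤ c) (hyz : y ≤ z) : A + B ≤ (k + 1 : ℕ) * (c * z) := by
  have h1 : c * y ≤ c * z := mul_le_mul_of_nonneg_left hyz hc
  have h2 := mul_le_mul_of_nonneg_left h1 (k.cast_nonneg (α := ℝ))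
  push_cast
  linarith

/-- For `D = (X - ρ_1) ⋯ (X - ρ_k)` some `M - X ^ 2` is a sum of squares modulo `D`. -/
lemma exists_const_sub_sq_eq_sum_sq_add {W : ℝ} {k : ℕ} (ρ : Fin k → ℝ) (hW : 1 ≤ W)
    (hρ : ∀ i, |ρ i| + 1 ≤ W) :
    ∃ (M : ℝ) (ss : List (Polynomial ℝ)) (q : Polynomial ℝ),
      Polynomial.C M - Polynomial.X ^ 2 =
        (ss.map (· ^ 2)).sum + q * ∏ i, (Polynomial.X - Polynomial.C (ρ i)) ∧
      0 ≤ M ∧ M ≤ k * (3 * ((k + 1) * (2 * W) ^ (k + 2)) ^ 2) ∧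
      (ss.map fun s => wnorm W s ^ 2).sum ≤ k * (8 * ((k + 1) * (2 * W) ^ (k + 2)) ^ 2) ∧
      wnorm W q ≤ (k + 1) * (2 * W) ^ (k + 2) ∧
      (∀ s ∈ ss, s.natDegree ≤ k) ∧ q.natDegree ≤ k + 2 := by
  have hW0 : 0 ≤ W := by linarith
  induction k with
  | zero =>
    -- The empty product is $1$, so the ideal is everything.
    refine ⟨0, [], -Polynomial.X ^ 2, by simp, le_rfl, by simp, by simp, ?_, by simp, by simp⟩
    have : -Polynomial.X ^ 2 = Polynomial.monomial 2 (-1 : ℝ) := by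
      rw [← Polynomial.C_mul_X_pow_eq_monomial]; simp
    rw [this, wnorm_monomial, abs_neg, abs_one]
    simp only [Nat.cast_zero, zero_add, one_mul]
    gcongr
    linarith
  | succ k ih =>
    obtain ⟨M, ss, q, hid, hM0, hM, hss, hq, hsdeg, hqdeg⟩ :=
      ih (fun i => ρ i.succ) fun i => hρ _
    rw [Fin.prod_univ_succ]
    have hE : wnorm W (∏ i : Fin k, (Polynomial.X - Polynomial.C (ρ i.succ))) ≤ (2 * W) ^ k :=
      wnorm_prod_X_sub_C_le _ hW0 fun i => by linarith [hρ i.succ]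
    have hEdeg := natDegree_prod_X_sub_C_fin fun i : Fin k => ρ i.succ
    set E := ∏ i : Fin k, (Polynomial.X - Polynomial.C (ρ i.succ))
    -- With $D=(X-\rho_0)E$, the old remainder $qE$ equals $cE+q_1D$, and only $cE$ must still be
    -- absorbed. Since $(u+vE)^2=u^2+(2uv+v^2e)E+v^2E_1D$, this is done by solving $2uv+v^2e=c$, at
    -- the price of raising $M$ by $u^2$.
    obtain ⟨q₁, hq₁, hq₁n, hq₁d⟩ := exists_eq_C_eval_add_X_sub_C_mul (hρ 0) q
    obtain ⟨E₁, hE₁, hE₁n, hE₁d⟩ := exists_eq_C_eval_add_X_sub_C_mul (hρ 0) E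
    have hc := abs_eval_le_wnorm (x := ρ 0) (W := W) (by linarith [hρ 0]) q
    have he := abs_eval_le_wnorm (x := ρ 0) (W := W) (by linarith [hρ 0]) E
    set c := q.eval (ρ 0)
    set e := E.eval (ρ 0)
    obtain ⟨u, v, hu, huv, hv, hu0⟩ := exists_small_root c e
    have h2W : 1 ≤ 2 * W := by linarith
    have hk0 : (0 : ℝ) ≤ k := k.cast_nonneg
    set Y : ℝ := (k + 1) * (2 * W) ^ (k + 2) with hYdef
    have hpow1 : (1 : ℝ) ≤ (2 * W) ^ k := one_le_pow₀ h2W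
    have hpow : (2 * W) ^ k ≤ (2 * W) ^ (k + 2) := pow_le_pow_right₀ h2W (by omega)
    have hpow' : (2 * W) ^ (k + 2) ≤ (2 * W) ^ (k + 1 + 2) := pow_le_pow_right₀ h2W (by omega)
    have hEY : (2 * W) ^ k ≤ Y := by nlinarith
    have hY1 : 1 ≤ Y := hpow1.trans hEY
    -- The cofactor grows only additively, by the norm of $E_1$; this is why its bound has the
    -- factor $k+1$.
    have hYY : Y + (2 * W) ^ k ≤ ((k + 1 : ℕ) + 1) * (2 * W) ^ (k + 1 + 2) := by
      push_cast
      nlinarith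
    have hYY' : Y ^ 2 ≤ (((k + 1 : ℕ) + 1) * (2 * W) ^ (k + 1 + 2)) ^ 2 := by
      refine pow_le_pow_left₀ (by linarith) ?_ 2
      linarith
    generalize ((((k + 1 : ℕ) : ℝ) + 1) * (2 * W) ^ (k + 1 + 2)) = Z at hYY hYY' ⊢
    have hcY : |c| ≤ Y := hc.trans hq
    have heY : |e| ≤ Y := he.trans (hE.trans hEY)
    have hu2 : u ^ 2 ≤ 3 * Y ^ 2 := by
      rw [hu, abs_mul, ← sq_abs c]
      have h1 : |e| * |c| ≤ Y * Y := mul_le_mul heY hcY (abs_nonneg _) (by linarith)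
      have h2 : |c| ^ 2 ≤ Y ^ 2 := pow_le_pow_left₀ (abs_nonneg _) hcY 2
      nlinarith
    have hv2 : v ^ 2 ≤ 1 := by rw [← sq_abs]; exact pow_le_one₀ (abs_nonneg _) hv
    refine ⟨M + u ^ 2, (Polynomial.C u + Polynomial.C v * E) :: ss,
      q₁ + Polynomial.C (-v ^ 2) * E₁, ?_, by positivity, ?_, ?_, ?_, ?_, ?_⟩
    · rw [List.map_cons, List.sum_cons]
      have hsum : (ss.map (· ^ 2)).sum = Polynomial.C M - Polynomial.X ^ 2 - q * E := by
        rw [hid]; ring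
      have huv' := congrArg Polynomial.C huv
      simp only [map_add, map_mul, map_pow, map_neg] at huv' ⊢
      simp only [Polynomial.C_ofNat] at huv'
      rw [hsum]
      linear_combination E * hq₁ - (Polynomial.C v ^ 2 * E) * hE₁ - E * huv'
    · exact add_le_succ_mul hM hu2 (by norm_num) hYY'
    · rw [List.map_cons, List.sum_cons]
      have h1 : wnorm W (Polynomial.C u + Polynomial.C v * E) ≤ u + Y := by
        refine (wnorm_add_le hW0 _ _).trans ?_
        rw [wnorm_C, abs_of_nonneg hu0]
        have h2 := wnorm_C_mul_le hW0 v E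
        have h3 : |v| * wnorm W E ≤ 1 * Y :=
          mul_le_mul hv (hE.trans hEY) (wnorm_nonneg hW0 _) zero_le_one
        linarith
      have h2 := pow_le_pow_left₀ (wnorm_nonneg hW0 _) h1 2
      have h3 : (u + Y) ^ 2 ≤ 8 * Y ^ 2 := by nlinarith [sq_nonneg (u - Y)]
      rw [add_comm]
      exact add_le_succ_mul hss (h2.trans h3) (by norm_num) hYY'
    · refine (wnorm_add_le hW0 _ _).trans ?_
      have h2 := wnorm_C_mul_le hW0 (-v ^ 2) E₁
      rw [abs_neg, abs_of_nonneg (sq_nonneg v)] at h2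
      have h3 : v ^ 2 * wnorm W E₁ ≤ 1 * (2 * W) ^ k :=
        mul_le_mul hv2 (hE₁n.trans hE) (wnorm_nonneg hW0 _) zero_le_one
      linarith
    · intro s hs
      rcases List.mem_cons.1 hs with rfl | hs
      · refine (Polynomial.natDegree_C_add.trans_le (Polynomial.natDegree_C_mul_le _ _)).trans ?_
        omega
      · exact (hsdeg s hs).trans (by omega)
    · refine (Polynomial.natDegree_add_le _ _).trans (max_le (by omega) ?_)
      exact (Polynomial.natDegree_C_mul_le _ _).trans (by omega)

/-! ### Sum-of-squares proofs with bounded `ℓ¹` norms -/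

lemma totalDegree_C_mul_le {σ : Type*} (a : ℝ) (p : MvPolynomial σ ℝ) :
    (C a * p).totalDegree ≤ p.totalDegree := by
  simpa only [totalDegree_C, zero_add] using totalDegree_mul (C a) p

/-- There is an SoS proof of `r ≥ 0` of degree at most `e`, in which the squares of the norms of the
`s_i` and the norms of the `h_i` are bounded by `B`. -/
def HasL1Proof {n : ℕ} {ι : Type} [Fintype ι] (p : ι → MvPolynomial (Fin n) ℝ)
    (r : MvPolynomial (Fin n) ℝ) (e : ℕ) (B : ℝ) : Prop :=
  ∃ w : SoSProof p r, w.DegreeLE e ∧ (∀ i, l1 (w.s i) ^ 2 ≤ B) ∧ ∀ i, l1 (w.h i) ≤ B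

namespace HasL1Proof

variable {n : ℕ} {ι : Type} [Fintype ι] {p : ι → MvPolynomial (Fin n) ℝ}
  {r r₁ r₂ : MvPolynomial (Fin n) ℝ} {e : ℕ} {B B₁ B₂ : ℝ}

lemma mono (h : HasL1Proof p r e B₁) (hB : B₁ ≤ B₂) : HasL1Proof p r e B₂ := by
  obtain ⟨w, hd, hs, hh⟩ := h
  exact ⟨w, hd, fun i => (hs i).trans hB, fun i => (hh i).trans hB⟩

lemma hasSoSProof (h : HasL1Proof p r e B) (hB : 1 ≤ B) : HasSoSProof p r e B := by
  obtain ⟨w, hd, hs, hh⟩ := h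
  refine ⟨w, hd, fun i α => (abs_coeff_le_l1 _ α).trans ?_,
    fun i α => (abs_coeff_le_l1 _ α).trans (hh i)⟩
  have := l1_nonneg (w.s i)
  nlinarith [hs i]

lemma zero (hB : 0 ≤ B) : HasL1Proof p 0 e B :=
  ⟨⟨0, Fin.elim0, 0, by simp⟩, ⟨fun i => i.elim0, fun i => by simp⟩, fun i => i.elim0,
    fun i => by simpa [l1_zero] using hB⟩

lemma add (h₁ : HasL1Proof p r₁ e B₁) (h₂ : HasL1Proof p r₂ e B₂) (hB₁ : 0 ≤ B₁) (hB₂ : 0 ≤ B₂) :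
    HasL1Proof p (r₁ + r₂) e (B₁ + B₂) := by
  obtain ⟨w₁, hd₁, hs₁, hh₁⟩ := h₁
  obtain ⟨w₂, hd₂, hs₂, hh₂⟩ := h₂
  refine ⟨⟨w₁.t + w₂.t, Fin.append w₁.s w₂.s, w₁.h + w₂.h, ?_⟩, ⟨fun i => ?_, fun i => ?_⟩,
    fun i => ?_, fun i => ?_⟩
  · conv_lhs => rw [w₁.identity, w₂.identity]
    simp only [Fin.sum_univ_add, Fin.append_left, Fin.append_right, Pi.add_apply, add_mul,
      Finset.sum_add_distrib]
    ring
  · refine Fin.addCases (fun i => ?_) (fun i => ?_) i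
    · simpa using hd₁.1 i
    · simpa using hd₂.1 i
  · simp only [Pi.add_apply, add_mul]
    exact (totalDegree_add _ _).trans (max_le (hd₁.2 i) (hd₂.2 i))
  · refine Fin.addCases (fun i => ?_) (fun i => ?_) i
    · simp only [Fin.append_left]
      linarith [hs₁ i]
    · simp only [Fin.append_right]
      linarith [hs₂ i]
  · exact (l1_add_le _ _).trans (add_le_add (hh₁ i) (hh₂ i))

/-- The squares absorb $c$ as $\sqrt c$, so squared norms of the $s_i$ and norms of the $h_i$ both
scale by $c$. -/
lemma C_mul {c : ℝ} (hc : 0 ≤ c) (h : HasL1Proof p r e B) :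
    HasL1Proof p (C c * r) e (c * B) := by
  obtain ⟨w, hd, hs, hh⟩ := h
  have hsq (q : MvPolynomial (Fin n) ℝ) : (C √c * q) ^ 2 = C c * q ^ 2 := by
    rw [mul_pow, ← C_pow, Real.sq_sqrt hc]
  refine ⟨⟨w.t, fun i => C √c * w.s i, fun i => C c * w.h i, ?_⟩, ⟨fun i => ?_, fun i => ?_⟩,
    fun i => ?_, fun i => ?_⟩
  · conv_lhs => rw [w.identity]
    simp only [hsq, mul_assoc, Finset.mul_sum, mul_add]
  · simp only [hsq]
    exact (totalDegree_C_mul_le _ _).trans (hd.1 i)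
  · simp only [mul_assoc]
    exact (totalDegree_C_mul_le _ _).trans (hd.2 i)
  · refine (pow_le_pow_left₀ (l1_nonneg _) (l1_C_mul_le _ _) 2).trans ?_
    rw [mul_pow, sq_abs, Real.sq_sqrt hc]
    exact mul_le_mul_of_nonneg_left (hs i) hc
  · refine (l1_C_mul_le _ _).trans ?_
    rw [abs_of_nonneg hc]
    exact mul_le_mul_of_nonneg_left (hh i) hc

lemma sq (s : MvPolynomial (Fin n) ℝ) (hs : 2 * s.totalDegree ≤ e) :
    HasL1Proof p (s ^ 2) e (l1 s ^ 2) :=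
  ⟨⟨1, fun _ => s, 0, by simp⟩, ⟨fun _ => (totalDegree_pow s 2).trans hs, fun i => by simp⟩,
    fun _ => le_rfl, fun i => by simpa [l1_zero] using sq_nonneg (l1 s)⟩

lemma mul (q : MvPolynomial (Fin n) ℝ) (i : ι) (hq : q.totalDegree + (p i).totalDegree ≤ e) :
    HasL1Proof p (q * p i) e (l1 q) := by
  classical
  refine ⟨⟨0, Fin.elim0, Pi.single i q, ?_⟩, ⟨fun i => i.elim0, fun l => ?_⟩, fun i => i.elim0,
    fun l => ?_⟩
  · rw [Finset.sum_eq_single i]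
    · simp
    · intro l _ hl
      simp [Pi.single_eq_of_ne hl]
    · simp
  · by_cases h : l = i
    · subst h
      simpa using (totalDegree_mul _ _).trans hq
    · simp [Pi.single_eq_of_ne h]
  · by_cases h : l = i
    · subst h
      simp
    · simpa [Pi.single_eq_of_ne h, l1_zero] using l1_nonneg q

lemma list_sum_sq (ss : List (MvPolynomial (Fin n) ℝ)) (hs : ∀ s ∈ ss, 2 * s.totalDegree ≤ e) :
    HasL1Proof p (ss.map (· ^ 2)).sum e (ss.map fun s => l1 s ^ 2).sum := by
  induction ss with
  | nil => simpa using zero le_rfl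
  | cons s ss ih =>
    rw [List.map_cons, List.map_cons, List.sum_cons, List.sum_cons]
    refine (sq s (hs s List.mem_cons_self)).add (ih fun s h => hs s (List.mem_cons_of_mem _ h))
      (sq_nonneg _) (List.sum_nonneg ?_)
    simp only [List.mem_map]
    rintro _ ⟨s, _, rfl⟩
    exact sq_nonneg _

/-- A nonnegative constant is a sum of many small squares. -/
lemma const {c : ℝ} (hc : 0 ≤ c) : HasL1Proof p (C c) e 1 := by
  -- The number of squares is not bounded, so any constant, in particular a large part of
  -- $\varepsilon$, costs only $1$.
  obtain ⟨N, hN⟩ := exists_nat_gt c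
  have hN0 : (0 : ℝ) < N := hc.trans_lt hN
  refine ⟨⟨N, fun _ => C √(c / N), 0, ?_⟩, ⟨fun _ => ?_, fun i => by simp⟩, fun _ => ?_,
    fun i => by simp [l1_zero]⟩
  · simp only [← C_pow, Real.sq_sqrt (div_nonneg hc hN0.le)]
    simp only [Finset.sum_const, Finset.card_univ, Fintype.card_fin, nsmul_eq_mul, Pi.zero_apply,
      zero_mul, smul_zero, add_zero]
    rw [← C_eq_coe_nat, ← map_mul C, mul_div_cancel₀ _ hN0.ne']
  · simp only [← C_pow, totalDegree_C]
    exact Nat.zero_le _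
  · simp only [l1_C, sq_abs, Real.sq_sqrt (div_nonneg hc hN0.le)]
    rw [div_le_one hN0]
    exact hN.le

/-- From `-r ^ 2 ≥ 0` derive `r + ε ≥ 0`. -/
lemma add_C_of_neg_sq {N ε : ℝ} (h : HasL1Proof p (-r ^ 2) e B) (hB : 0 ≤ B) (hε : 0 < ε)
    (hdeg : 2 * r.totalDegree ≤ e) (hN : l1 r ≤ N) :
    HasL1Proof p (r + C ε) e ((2 : ℝ) ^ lgInv ε * (B + N ^ 2 + 3)) := by
  -- Only $\delta$ is used to complete the square, at cost $1/\delta=2^{\lg^+(1/\varepsilon)}$; the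
  -- rest $\varepsilon-\delta$ is left to `const`.
  set δ := min ε 1
  have hδ : 0 < δ := lt_min hε one_pos
  have hδ1 : δ ≤ 1 := min_le_right _ _
  have hδε : δ ≤ ε := min_le_left _ _
  have hΛ : (2 : ℝ) ^ lgInv ε = 1 / δ := by
    rw [lgInv]
    rcases le_total ε 1 with h1 | h1
    · rw [max_eq_right, Real.rpow_logb (by norm_num) (by norm_num) (by positivity)]
      · simp [δ, min_eq_left h1]
      · refine Real.logb_nonneg (by norm_num) ?_
        rwa [one_le_div hε]
    · rw [max_eq_left]
      · simp [δ, min_eq_right h1]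
      · refine Real.logb_nonpos (by norm_num) (by positivity) ?_
        rwa [div_le_one hε]
  set t := √δ
  have ht0 : 0 < t := Real.sqrt_pos.2 hδ
  have ht : t ^ 2 = δ := Real.sq_sqrt hδ.le
  have hid : r + C ε = (C (1 / (2 * t)) * r + C t) ^ 2 + C (1 / (4 * δ)) * (-r ^ 2) +
      C (ε - δ) := by
    have h1 : (C (1 / (2 * t)) : MvPolynomial (Fin n) ℝ) ^ 2 = C (1 / (4 * δ)) := by
      rw [← C_pow, ← ht]
      congr 1
      field_simp
      norm_num
    have h2 : (C (1 / (2 * t)) : MvPolynomial (Fin n) ℝ) * C t * 2 = 1 := by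
      rw [show (2 : MvPolynomial (Fin n) ℝ) = C 2 from (map_ofNat C 2).symm, ← map_mul C,
        ← map_mul C, ← C_1]
      congr 1
      field_simp
    have h3 : (C t : MvPolynomial (Fin n) ℝ) ^ 2 = C δ := by rw [← C_pow, ht]
    rw [C_sub]
    linear_combination (-r ^ 2) * h1 - r * h2 - h3
  rw [hid, hΛ]
  have hN0 : 0 ≤ N := (l1_nonneg r).trans hN
  have hsq : HasL1Proof p ((C (1 / (2 * t)) * r + C t) ^ 2) e (1 / δ * (N ^ 2 + 2)) := by
    refine (sq _ ?_).mono ?_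
    · have h1 : (C (1 / (2 * t)) * r + C t).totalDegree ≤ r.totalDegree := by
        refine (totalDegree_add _ _).trans (max_le ?_ (by simp))
        exact totalDegree_C_mul_le _ r
      omega
    · have h1 : l1 (C (1 / (2 * t)) * r + C t) ≤ 1 / (2 * t) * N + t := by
        refine (l1_add_le _ _).trans ?_
        rw [l1_C, abs_of_pos ht0]
        gcongr
        refine (l1_C_mul_le _ _).trans ?_
        rw [abs_of_pos (by positivity)]
        gcongr
      refine (pow_le_pow_left₀ (l1_nonneg _) h1 2).trans ?_
      have h2 : (1 / (2 * t) * N + t) ^ 2 ≤ 2 * ((1 / (2 * t) * N) ^ 2 + t ^ 2) := by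
        nlinarith [sq_nonneg (1 / (2 * t) * N - t)]
      refine h2.trans ?_
      have h3 : (1 / (2 * t) * N) ^ 2 = 1 / δ * (N ^ 2 / 4) := by
        rw [← ht]
        field_simp
        ring
      have h4 : 1 ≤ 1 / δ := by rwa [one_le_div hδ]
      rw [h3, ht]
      nlinarith [sq_nonneg N, mul_nonneg (by linarith : 0 ≤ 1 / δ) (sq_nonneg N)]
  have h1δ : 1 ≤ 1 / δ := by rwa [one_le_div hδ]
  refine ((hsq.add (h.C_mul (c := 1 / (4 * δ)) (by positivity)) (by positivity)
    (by positivity)).add (const (c := ε - δ) (by linarith)) (by positivity) zero_le_one).mono ?_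
  have h5 : 1 / (4 * δ) * B ≤ 1 / δ * B := by
    gcongr
    linarith
  nlinarith

end HasL1Proof

/-! ### Bounds from bit lengths -/

lemma abs_le_two_pow_ratBits (q : ℚ) : |(q : ℝ)| ≤ 2 ^ ratBits q := by
  have h1 : |(q : ℝ)| ≤ (q.num.natAbs : ℝ) := by
    have h : |(q : ℝ)| * q.den = (q.num.natAbs : ℝ) := by
      rw [Nat.cast_natAbs, Int.cast_abs, ← Rat.cast_intCast q.num, ← Rat.mul_den_eq_num,
        Rat.cast_mul, abs_mul, Rat.cast_natCast, Nat.abs_cast]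
    rw [← h]
    exact le_mul_of_one_le_right (abs_nonneg _) (by exact_mod_cast q.den_pos)
  have h2 : q.num.natAbs ≤ 2 ^ ratBits q :=
    (Nat.lt_size_self _).le.trans (Nat.pow_le_pow_right two_pos (by unfold ratBits; omega))
  exact h1.trans (by exact_mod_cast h2)

lemma den_le_two_pow_ratBits (q : ℚ) : (q.den : ℝ) ≤ 2 ^ ratBits q := by
  have h2 : q.den ≤ 2 ^ ratBits q :=
    (Nat.lt_size_self _).le.trans (Nat.pow_le_pow_right two_pos (by unfold ratBits; omega))
  exact_mod_cast h2

section polyBits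

variable {n : ℕ}

lemma ratBits_coeff_le_polyBits (p : MvPolynomial (Fin n) ℚ) {α : Fin n →₀ ℕ}
    (h : α ∈ p.support) : ratBits (coeff α p) ≤ polyBits p := by
  have := Finset.single_le_sum (f := fun α => ratBits (coeff α p) + monomialBits α)
    (fun _ _ => Nat.zero_le _) h
  unfold polyBits
  omega

lemma abs_coeff_le_of_polyBits_le {p : MvPolynomial (Fin n) ℚ} {S : ℕ} (hS : polyBits p ≤ S)
    (α : Fin n →₀ ℕ) : |((coeff α p : ℚ) : ℝ)| ≤ 2 ^ S := by
  by_cases h : α ∈ p.support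
  · exact (abs_le_two_pow_ratBits _).trans
      (pow_le_pow_right₀ one_le_two ((ratBits_coeff_le_polyBits p h).trans hS))
  · rw [notMem_support_iff.1 h]
    simp

lemma den_coeff_le_of_polyBits_le {p : MvPolynomial (Fin n) ℚ} {S : ℕ} (hS : polyBits p ≤ S)
    (α : Fin n →₀ ℕ) : ((coeff α p).den : ℝ) ≤ 2 ^ S := by
  by_cases h : α ∈ p.support
  · exact (den_le_two_pow_ratBits _).trans
      (pow_le_pow_right₀ one_le_two ((ratBits_coeff_le_polyBits p h).trans hS))
  · rw [notMem_support_iff.1 h]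
    simpa using one_le_pow₀ (M₀ := ℝ) one_le_two

lemma coeff_toReal (p : MvPolynomial (Fin n) ℚ) (α : Fin n →₀ ℕ) :
    coeff α (toReal p) = ((coeff α p : ℚ) : ℝ) := by
  simp [coeff_map]

lemma card_support_le_polyBits (p : MvPolynomial (Fin n) ℚ) : p.support.card ≤ polyBits p := by
  unfold polyBits
  have := Finset.card_nsmul_le_sum p.support
    (fun α => ratBits (coeff α p) + monomialBits α) 1 fun α _ => by unfold ratBits; omega
  simp only [smul_eq_mul, mul_one] at this
  omega

/-- At most $S\le 2^S$ terms, each with a coefficient of absolute value at most $2^S$. -/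
lemma l1_toReal_le {p : MvPolynomial (Fin n) ℚ} {S : ℕ} (hS : polyBits p ≤ S) :
    l1 (toReal p) ≤ (2 ^ S) ^ 2 := by
  have hsupp : (toReal p).support ⊆ p.support := support_map_subset _ _
  rw [l1_eq_sum_of_support_subset _ hsupp]
  refine (Finset.sum_le_card_nsmul _ _ (2 ^ S) fun α _ => ?_).trans ?_
  · rw [coeff_toReal]
    exact abs_coeff_le_of_polyBits_le hS α
  · rw [nsmul_eq_mul, sq]
    refine mul_le_mul_of_nonneg_right ?_ (by positivity)
    have : p.support.card ≤ 2 ^ S :=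
      ((card_support_le_polyBits p).trans hS).trans Nat.lt_two_pow_self.le
    exact_mod_cast this

lemma totalDegree_toReal_le (p : MvPolynomial (Fin n) ℚ) :
    (toReal p).totalDegree ≤ p.totalDegree :=
  Finset.sup_mono (support_map_subset _ _)

end polyBits

/-- A nonzero `2 × 2` determinant of rationals with small denominators is not small. -/
lemma one_le_abs_det_mul {a b c d : ℚ} {T : ℝ} (ha : (a.den : ℝ) ≤ T) (hb : (b.den : ℝ) ≤ T)
    (hc : (c.den : ℝ) ≤ T) (hd : (d.den : ℝ) ≤ T) (h : a * b - c * d ≠ 0) :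
    1 ≤ |(a * b - c * d : ℝ)| * T ^ 4 := by
  -- Clearing the four denominators gives a nonzero integer.
  have hz : (a * b - c * d) * (a.den * b.den * c.den * d.den) =
      ((a.num * b.num * c.den * d.den - c.num * d.num * a.den * b.den : ℤ) : ℚ) := by
    push_cast
    simp only [← Rat.mul_den_eq_num]
    ring
  have hne : (a * b - c * d) * (a.den * b.den * c.den * d.den) ≠ 0 := by
    refine mul_ne_zero h ?_
    have := a.den_ne_zero
    have := b.den_ne_zero
    have := c.den_ne_zero
    have := d.den_ne_zero
    positivity
  have h1 : (1 : ℚ) ≤ |(a * b - c * d) * (a.den * b.den * c.den * d.den)| := by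
    rw [hz] at hne ⊢
    exact_mod_cast Int.one_le_abs (by exact_mod_cast hne)
  have h2 : (1 : ℝ) ≤ |(a * b - c * d : ℝ) * (a.den * b.den * c.den * d.den)| := by
    exact_mod_cast h1
  refine h2.trans ?_
  rw [abs_mul]
  refine mul_le_mul_of_nonneg_left ?_ (abs_nonneg _)
  rw [abs_of_nonneg (by positivity), show T ^ 4 = T * T * T * T by ring]
  have : 0 ≤ T := (Nat.cast_nonneg _).trans ha
  gcongr

/-- The scalars of a linear combination of rational polynomials can be chosen small. -/
lemma exists_small_linear_combination {n S : ℕ} {f g h : MvPolynomial (Fin n) ℚ}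
    (hf : polyBits f ≤ S) (hg : polyBits g ≤ S) (hh : polyBits h ≤ S) {a b : ℝ}
    (H : toReal h = C a * toReal f + C b * toReal g) :
    ∃ a' b' : ℝ, toReal h = C a' * toReal f + C b' * toReal g ∧
      |a'| ≤ 2 * (2 ^ S) ^ 6 ∧ |b'| ≤ 2 * (2 ^ S) ^ 6 := by
  have hT : (1 : ℝ) ≤ 2 ^ S := one_le_pow₀ one_le_two
  have hfn := abs_coeff_le_of_polyBits_le hf
  have hgn := abs_coeff_le_of_polyBits_le hg
  have hhn := abs_coeff_le_of_polyBits_le hh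
  have hfd := den_coeff_le_of_polyBits_le hf
  have hgd := den_coeff_le_of_polyBits_le hg
  have hc : ∀ γ, ((coeff γ h : ℚ) : ℝ) = a * (coeff γ f : ℚ) + b * (coeff γ g : ℚ) := by
    intro γ
    have := congrArg (coeff γ) H
    simpa only [coeff_toReal, coeff_add, coeff_C_mul] using this
  generalize (2 : ℝ) ^ S = T at *
  have hT0 : 0 ≤ T := by linarith
  have key : ∀ x y z : ℝ, x * y = z → 1 ≤ |y| * T ^ 4 → |z| ≤ 2 * T ^ 2 → |x| ≤ 2 * T ^ 6 := by
    intro x y z hxy hy hz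
    calc |x| ≤ |x| * (|y| * T ^ 4) := le_mul_of_one_le_right (abs_nonneg _) hy
      _ = |z| * T ^ 4 := by rw [← hxy, abs_mul]; ring
      _ ≤ 2 * T ^ 2 * T ^ 4 := by gcongr
      _ = 2 * T ^ 6 := by ring
  have det_le : ∀ x y z w : ℝ, |x| ≤ T → |y| ≤ T → |z| ≤ T → |w| ≤ T →
      |x * y - z * w| ≤ 2 * T ^ 2 := by
    intro x y z w hx hy hz hw
    have h1 := abs_sub (x * y) (z * w)
    rw [abs_mul, abs_mul] at h1
    have h2 := mul_le_mul hx hy (abs_nonneg _) hT0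
    have h3 := mul_le_mul hz hw (abs_nonneg _) hT0
    nlinarith
  have single_le : ∀ x : ℝ, |x| ≤ T → |x| ≤ 2 * T ^ 2 := fun x hx => by nlinarith
  have single_ge : ∀ x : ℚ, (x.den : ℝ) ≤ T → x ≠ 0 → 1 ≤ |(x : ℝ)| * T ^ 4 := by
    intro x hx hx0
    have := one_le_abs_det_mul (a := x) (b := 1) (c := 0) (d := 0) (T := T) hx (by simpa)
      (by simpa) (by simpa) (by simpa)
    simpa using this
  -- If some minor is nonzero, $a,b$ are already small by Cramer's rule: numerators are at most
  -- $2T^2$, the determinant at least $T^{-4}$.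
  by_cases hdet : ∃ α β, coeff α f * coeff β g - coeff β f * coeff α g ≠ 0
  · obtain ⟨α, β, hne⟩ := hdet
    have h1 := one_le_abs_det_mul (hfd α) (hgd β) (hfd β) (hgd α) hne
    refine ⟨a, b, H, key a _
      ((coeff α h : ℚ) * (coeff β g : ℚ) - (coeff β h : ℚ) * (coeff α g : ℚ)) ?_ h1
      (det_le _ _ _ _ (hhn _) (hgn _) (hhn _) (hgn _)),
      key b _ ((coeff α f : ℚ) * (coeff β h : ℚ) - (coeff β f : ℚ) * (coeff α h : ℚ)) ?_ h1
      (det_le _ _ _ _ (hfn _) (hhn _) (hfn _) (hhn _))⟩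
    · rw [hc, hc]; ring
    · rw [hc, hc]; ring
  -- Now $f,g$ are linearly dependent, and one of them alone suffices.
  push Not at hdet
  by_cases hf0 : f = 0
  · subst hf0
    by_cases hg0 : g = 0
    · subst hg0
      exact ⟨0, 0, by simpa using H, by simp; positivity, by simp; positivity⟩
    · obtain ⟨β, hβ⟩ := MvPolynomial.ne_zero_iff.1 hg0
      refine ⟨0, b, by simpa using H, by simp; positivity,
        key b _ (coeff β h : ℚ) ?_ (single_ge _ (hgd β) hβ) (single_le _ (hhn β))⟩
      rw [hc]; simp
  · obtain ⟨α, hα⟩ := MvPolynomial.ne_zero_iff.1 hf0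
    have hα' : ((coeff α f : ℚ) : ℝ) ≠ 0 := by exact_mod_cast hα
    refine ⟨a + b * (coeff α g : ℚ) / (coeff α f : ℚ), 0, ?_,
      key _ _ (coeff α h : ℚ) ?_ (single_ge _ (hfd α) hα) (single_le _ (hhn α)),
      by simp; positivity⟩
    · ext γ
      simp only [coeff_toReal, coeff_add, coeff_C_mul, hc γ]
      have h1 : ((coeff α f : ℚ) * (coeff γ g : ℚ) - (coeff γ f : ℚ) * (coeff α g : ℚ) : ℝ) = 0 := by
        exact_mod_cast hdet α γ
      field_simp
      linear_combination b * h1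
    · rw [hc α]
      field_simp

/-! ### Domain polynomials -/

section domain

variable {n k : ℕ}

/-- The univariate polynomial `(X - ρ_1) ⋯ (X - ρ_k)` over the reals. -/
def realDomainPoly (ρ : Fin k → ℚ) : Polynomial ℝ :=
  ∏ i, (Polynomial.X - Polynomial.C (ρ i : ℝ))

lemma toReal_domainPoly (ρ : Fin k → ℚ) (j : Fin n) :
    toReal (domainPoly ρ j) = Polynomial.aeval (X j) (realDomainPoly ρ) := by
  simp [toReal, domainPoly, realDomainPoly, map_prod, MvPolynomial.algebraMap_eq]

lemma totalDegree_aeval_X_le {σ : Type*} (j : σ) (p : Polynomial ℝ) :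
    (Polynomial.aeval (X j : MvPolynomial σ ℝ) p).totalDegree ≤ p.natDegree := by
  rw [Polynomial.aeval_eq_sum_range' (Nat.lt_succ_self p.natDegree)]
  refine totalDegree_finsetSum_le fun i hi => ?_
  rw [smul_eq_C_mul]
  refine (totalDegree_C_mul_le _ _).trans ?_
  rw [totalDegree_X_pow]
  exact Nat.lt_succ_iff.1 (Finset.mem_range.1 hi)

lemma coeff_single_aeval_X {σ : Type*} (j : σ) (p : Polynomial ℝ) (l : ℕ) :
    coeff (Finsupp.single j l) (Polynomial.aeval (X j : MvPolynomial σ ℝ) p) = p.coeff l := by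
  classical
  rw [Polynomial.aeval_eq_sum_range' (Nat.lt_succ_self p.natDegree), coeff_sum]
  simp only [smul_eq_C_mul, coeff_C_mul, coeff_X_pow, (Finsupp.single_injective j).eq_iff,
    mul_ite, mul_one, mul_zero]
  rw [Finset.sum_ite_eq']
  split_ifs with h
  · rfl
  · refine (Polynomial.coeff_eq_zero_of_natDegree_lt ?_).symm
    simpa using h

lemma totalDegree_toReal_domainPoly_le (ρ : Fin k → ℚ) (j : Fin n) :
    (toReal (domainPoly ρ j)).totalDegree ≤ k := by
  rw [toReal_domainPoly]
  exact (totalDegree_aeval_X_le _ _).trans (natDegree_prod_X_sub_C_fin _).le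

/-- The domain values are bounded in terms of the bit length of a domain polynomial. -/
lemma abs_le_of_polyBits_domainPoly_le {ρ : Fin k → ℚ} {j : Fin n} {S : ℕ}
    (h : polyBits (domainPoly ρ j) ≤ S) (i : Fin k) : |(ρ i : ℝ)| ≤ 2 ^ S + 1 := by
  have hmonic : (realDomainPoly ρ).Monic :=
    Polynomial.monic_prod_of_monic _ _ fun i _ => Polynomial.monic_X_sub_C _
  have hroot : (realDomainPoly ρ).IsRoot (ρ i : ℝ) := by
    rw [Polynomial.IsRoot, realDomainPoly, Polynomial.eval_prod]
    exact Finset.prod_eq_zero (Finset.mem_univ i) (by simp)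
  -- Cauchy's bound: a root of a monic polynomial is smaller than $1$ plus its largest lower
  -- coefficient in absolute value.
  have hlt := hroot.norm_lt_cauchyBound hmonic.ne_zero
  have hcoeff : ∀ l, ‖(realDomainPoly ρ).coeff l‖₊ ≤ (2 : NNReal) ^ S := by
    intro l
    rw [← NNReal.coe_le_coe, coe_nnnorm, Real.norm_eq_abs, ← coeff_single_aeval_X j,
      ← toReal_domainPoly, coeff_toReal]
    simpa using abs_coeff_le_of_polyBits_le h (Finsupp.single j l)
  have hle : (realDomainPoly ρ).cauchyBound ≤ (2 : NNReal) ^ S + 1 := by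
    rw [Polynomial.cauchyBound, hmonic.leadingCoeff, nnnorm_one, div_one]
    gcongr
    exact Finset.sup_le fun l _ => hcoeff l
  have := hlt.le.trans hle
  rw [← NNReal.coe_le_coe, coe_nnnorm, Real.norm_eq_abs] at this
  simpa using this

end domain

/-! ### Simulation of the polynomial calculus -/

section simulation

variable {n m k : ℕ} {F : Fin m → MvPolynomial (Fin n) ℝ} {ρ : Fin k → ℚ}
  {r : MvPolynomial (Fin n) ℝ}

/-- A bound for the certificates of `M - x ^ 2 ≥ 0` over the domain. -/
def domainBound (W : ℝ) (k : ℕ) : ℝ := (k + 1) * (2 * W) ^ (k + 2)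

lemma one_le_domainBound {W : ℝ} (hW : 1 ≤ W) (k : ℕ) : 1 ≤ domainBound W k := by
  have h1 : (1 : ℝ) ≤ (2 * W) ^ (k + 2) := one_le_pow₀ (by linarith)
  have h2 : (0 : ℝ) ≤ k := k.cast_nonneg
  unfold domainBound
  nlinarith

/-- Over the domain some `M - x_j ^ 2` can be multiplied by any square. -/
lemma exists_hasL1Proof_const_sub_X_sq_mul {W N : ℝ} (hW : 1 ≤ W)
    (hρ : ∀ i, |(ρ i : ℝ)| + 1 ≤ W) (j : Fin n) {f : MvPolynomial (Fin n) ℝ} {e : ℕ}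
    (hf : 2 * (f.totalDegree + k) + 2 ≤ e) (hN : l1 f ≤ N) :
    ∃ M : ℝ, 0 ≤ M ∧ M ≤ 3 * (k * domainBound W k ^ 2) ∧
      HasL1Proof (system F ρ) ((C M - X j ^ 2) * f ^ 2) e
        (8 * (k * domainBound W k ^ 2) * N ^ 2 + domainBound W k * N ^ 2) := by
  obtain ⟨M, ss, q, hid, hM0, hM, hss, hq, hsdeg, hqdeg⟩ :=
    exists_const_sub_sq_eq_sum_sq_add (fun i => (ρ i : ℝ)) hW hρ
  rw [← domainBound] at hM hss hq
  refine ⟨M, hM0, by linarith, ?_⟩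
  have hN0 : 0 ≤ N := (l1_nonneg f).trans hN
  have hW0 : 0 ≤ W := by linarith
  have hdb := one_le_domainBound hW k
  have hid' := congrArg (Polynomial.aeval (X j : MvPolynomial (Fin n) ℝ)) hid
  rw [← realDomainPoly, map_sub, map_add, map_mul, map_pow, Polynomial.aeval_X,
    Polynomial.aeval_C, MvPolynomial.algebraMap_eq, map_list_sum, List.map_map,
    ← toReal_domainPoly] at hid'
  have hsq : (C M - X j ^ 2) * f ^ 2 =
      ((ss.map fun s => Polynomial.aeval (X j) s * f).map (· ^ 2)).sum +
        (Polynomial.aeval (X j) q * f ^ 2) * system F ρ (Sum.inr j) := by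
    rw [hid', add_mul, List.map_map, ← List.sum_map_mul_right]
    congr 1
    · simp [Function.comp_def, mul_pow]
    · simp only [system, Sum.elim_inr]
      ring
  rw [hsq]
  have hlist : HasL1Proof (system F ρ)
      ((ss.map fun s => Polynomial.aeval (X j) s * f).map (· ^ 2)).sum e
        (8 * (k * domainBound W k ^ 2) * N ^ 2) := by
    refine (HasL1Proof.list_sum_sq _ ?_).mono ?_
    · simp only [List.mem_map]
      rintro _ ⟨s, hs, rfl⟩
      have h1 := totalDegree_mul (Polynomial.aeval (X j : MvPolynomial (Fin n) ℝ) s) f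
      have h2 := totalDegree_aeval_X_le j s
      have h3 := hsdeg s hs
      omega
    · rw [List.map_map]
      have h1 : (ss.map ((fun s => l1 s ^ 2) ∘ fun s => Polynomial.aeval (X j) s * f)).sum ≤
          (ss.map fun s => wnorm W s ^ 2 * N ^ 2).sum := by
        refine List.sum_le_sum fun s _ => ?_
        rw [← mul_pow]
        refine pow_le_pow_left₀ (l1_nonneg _) ((l1_mul_le _ _).trans ?_) 2
        exact mul_le_mul (l1_aeval_X_le hW j s) hN (l1_nonneg _) (wnorm_nonneg hW0 _)
      rw [List.sum_map_mul_right] at h1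
      refine h1.trans (mul_le_mul_of_nonneg_right ?_ (by positivity))
      linarith
  have hideal : HasL1Proof (system F ρ)
      ((Polynomial.aeval (X j) q * f ^ 2) * system F ρ (Sum.inr j)) e
        (domainBound W k * N ^ 2) := by
    refine (HasL1Proof.mul _ _ ?_).mono ?_
    -- The degrees add up to $(k+2)+2\deg f+k$; this is the source of the $+2$ in `hf`.
    · have h1 := totalDegree_mul (Polynomial.aeval (X j : MvPolynomial (Fin n) ℝ) q) (f ^ 2)
      have h2 := totalDegree_aeval_X_le j q
      have h3 := totalDegree_pow f 2
      have h4 : (system F ρ (Sum.inr j)).totalDegree ≤ k := totalDegree_toReal_domainPoly_le ρ j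
      omega
    · refine (l1_mul_le _ _).trans (mul_le_mul ((l1_aeval_X_le hW j q).trans hq) ?_
        (l1_nonneg _) (by linarith))
      exact (l1_sq_le f).trans (pow_le_pow_left₀ (l1_nonneg _) hN 2)
  exact hlist.add hideal (by positivity) (by positivity)

/-- The factor by which the bounds grow in one step of a derivation of size `S`. -/
def stepFactor (W : ℝ) (k S : ℕ) : ℝ := 32 * (2 ^ S) ^ 16 * ((k + 1) * domainBound W k ^ 2)

lemma one_le_stepFactor {W : ℝ} (hW : 1 ≤ W) (k S : ℕ) : 1 ≤ stepFactor W k S := by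
  have h1 : (1 : ℝ) ≤ (2 ^ S) ^ 16 := one_le_pow₀ (one_le_pow₀ one_le_two)
  have h2 : (1 : ℝ) ≤ domainBound W k ^ 2 := one_le_pow₀ (one_le_domainBound hW k)
  have h3 : (0 : ℝ) ≤ k := k.cast_nonneg
  have h4 : (1 : ℝ) ≤ (k + 1) * domainBound W k ^ 2 := by nlinarith
  exact one_le_mul_of_one_le_of_one_le (by linarith) h4

lemma PCDerivation.polyBits_line_le_size (π : PCDerivation F ρ r) (i : Fin (π.last + 1)) :
    polyBits (π.line i) ≤ π.size :=
  Finset.single_le_sum (f := fun i => polyBits (π.line i)) (fun _ _ => Nat.zero_le _)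
    (Finset.mem_univ i)

/-- Every line costs at least one bit, so $S$ also bounds the number of steps. -/
lemma PCDerivation.last_lt_size (π : PCDerivation F ρ r) : π.last + 1 ≤ π.size := by
  have := Finset.card_nsmul_le_sum Finset.univ (fun i => polyBits (π.line i)) 1
    fun i _ => by unfold polyBits; omega
  simpa [PCDerivation.size] using this

lemma PCDerivation.totalDegree_line_le (π : PCDerivation F ρ r) (i : Fin (π.last + 1)) :
    (toReal (π.line i)).totalDegree ≤ π.degree :=
  (totalDegree_toReal_le _).trans
    (Finset.le_sup (f := fun i => (π.line i).totalDegree) (Finset.mem_univ i))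

/-- Every line `f` of a derivation has an SoS proof of `-f ^ 2 ≥ 0`. -/
lemma PCDerivation.hasL1Proof_neg_line_sq (π : PCDerivation F ρ r) {W : ℝ} (hW : 1 ≤ W)
    (hρ : 0 < n → ∀ i, |(ρ i : ℝ)| + 1 ≤ W) (i : Fin (π.last + 1)) :
    HasL1Proof (system F ρ) (-toReal (π.line i) ^ 2) (4 * (π.degree + k))
      (stepFactor W k π.size ^ (i.val + 1)) := by
  induction i using WellFoundedLT.induction with
  | _ i ih =>
  have hK := one_le_stepFactor hW k π.size
  have hpow : ∀ i₁ < i, stepFactor W k π.size ^ (i₁.val + 1) ≤ stepFactor W k π.size ^ i.val :=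
    fun i₁ h => pow_le_pow_right₀ hK h
  have hKi : 1 ≤ stepFactor W k π.size ^ i.val := one_le_pow₀ hK
  have hl1 := fun i => l1_toReal_le (π.polyBits_line_le_size i)
  have hdeg := π.totalDegree_line_le
  have hT : (1 : ℝ) ≤ 2 ^ π.size := one_le_pow₀ one_le_two
  have hk0 : (0 : ℝ) ≤ k := k.cast_nonneg
  have hY1 := one_le_domainBound hW k
  have hY2 : 1 ≤ domainBound W k ^ 2 := one_le_pow₀ hY1
  have hkY : 1 ≤ (k + 1) * domainBound W k ^ 2 := by nlinarith
  have hax : ∀ l, toReal (π.line i) = system F ρ l →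
      HasL1Proof (system F ρ) (-toReal (π.line i) ^ 2) (4 * (π.degree + k))
        (stepFactor W k π.size ^ (i.val + 1)) := by
    intro l hl
    have h1 : -toReal (π.line i) ^ 2 = -toReal (π.line i) * system F ρ l := by
      rw [← hl]; ring
    rw [h1]
    refine (HasL1Proof.mul _ l ?_).mono ?_
    · rw [← hl, totalDegree_neg]
      have := hdeg i
      omega
    · rw [l1_neg, pow_succ']
      refine ((hl1 i).trans ?_).trans (le_mul_of_one_le_right (by linarith) hKi)
      have h2 : ((2 : ℝ) ^ π.size) ^ 2 ≤ (2 ^ π.size) ^ 16 := pow_le_pow_right₀ hT (by norm_num)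
      unfold stepFactor
      refine le_trans ?_ (le_mul_of_one_le_right (by positivity) hkY)
      have : (0 : ℝ) ≤ (2 ^ π.size) ^ 16 := by positivity
      linarith
  rcases π.step i with ⟨l, hl⟩ | ⟨j, hj⟩ | ⟨i₁, hi₁, i₂, hi₂, a, b, hab⟩ | ⟨i₁, hi₁, j, hj⟩
  · exact hax (Sum.inl l) hl
  · exact hax (Sum.inr j) (by rw [hj]; rfl)
  · obtain ⟨a, b, hab, ha, hb⟩ := exists_small_linear_combination (π.polyBits_line_le_size i₁)
      (π.polyBits_line_le_size i₂) (π.polyBits_line_le_size i) hab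
    have h₁ := ((ih i₁ hi₁).mono (hpow i₁ hi₁)).C_mul (c := 2 * a ^ 2) (by positivity)
    have h₂ := ((ih i₂ hi₂).mono (hpow i₂ hi₂)).C_mul (c := 2 * b ^ 2) (by positivity)
    have h₃ : HasL1Proof (system F ρ) ((C a * toReal (π.line i₁) + C (-b) * toReal (π.line i₂)) ^ 2)
        (4 * (π.degree + k)) ((4 * (2 ^ π.size) ^ 8) ^ 2) := by
      refine (HasL1Proof.sq _ ?_).mono ?_
      · have h4 := totalDegree_add (C a * toReal (π.line i₁)) (C (-b) * toReal (π.line i₂))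
        have h5 := totalDegree_C_mul_le a (toReal (π.line i₁))
        have h6 := totalDegree_C_mul_le (-b) (toReal (π.line i₂))
        have h7 := hdeg i₁
        have h8 := hdeg i₂
        have h9 := max_le (h5.trans h7) (h6.trans h8)
        omega
      · refine pow_le_pow_left₀ (l1_nonneg _) ?_ 2
        refine (l1_add_le _ _).trans ?_
        have h4 := l1_C_mul_le a (toReal (π.line i₁))
        have h5 := l1_C_mul_le (-b) (toReal (π.line i₂))
        rw [abs_neg] at h5
        have h6 := mul_le_mul ha (hl1 i₁) (l1_nonneg _) (by positivity)
        have h7 := mul_le_mul hb (hl1 i₂) (l1_nonneg _) (by positivity)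
        linarith
    have hid : -toReal (π.line i) ^ 2 =
        C (2 * a ^ 2) * (-toReal (π.line i₁) ^ 2) + C (2 * b ^ 2) * (-toReal (π.line i₂) ^ 2) +
          (C a * toReal (π.line i₁) + C (-b) * toReal (π.line i₂)) ^ 2 := by
      rw [hab]
      simp only [map_mul, map_pow, map_neg, map_ofNat]
      ring
    rw [hid]
    refine ((h₁.add h₂ (by positivity) (by positivity)).add h₃ (by positivity)
      (by positivity)).mono ?_
    have ha2 : a ^ 2 ≤ (2 * (2 ^ π.size) ^ 6) ^ 2 := sq_le_sq.2 (ha.trans (le_abs_self _))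
    have hb2 : b ^ 2 ≤ (2 * (2 ^ π.size) ^ 6) ^ 2 := sq_le_sq.2 (hb.trans (le_abs_self _))
    rw [pow_succ' _ i.val]
    generalize stepFactor W k π.size ^ i.val = K at *
    unfold stepFactor
    generalize (2 : ℝ) ^ π.size = T at *
    have hT16 : T ^ 12 ≤ T ^ 16 := pow_le_pow_right₀ hT (by norm_num)
    have hT0 : 0 ≤ T ^ 16 := by positivity
    -- This rule dictates the factor $32T^{16}$: the new square has norm at most $(4T^8)^2$, as
    -- scalars are at most $2T^6$ and lines at most $T^2$.
    calc 2 * a ^ 2 * K + 2 * b ^ 2 * K + (4 * T ^ 8) ^ 2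
        ≤ 2 * (2 * T ^ 6) ^ 2 * K + 2 * (2 * T ^ 6) ^ 2 * K + (4 * T ^ 8) ^ 2 := by gcongr
      _ = 16 * T ^ 12 * K + 16 * T ^ 16 * 1 := by ring
      _ ≤ 16 * T ^ 16 * K + 16 * T ^ 16 * K := by gcongr
      _ = 32 * T ^ 16 * 1 * K := by ring
      _ ≤ 32 * T ^ 16 * ((k + 1) * domainBound W k ^ 2) * K := by gcongr
  -- For $f\ne0$ the line $x_jf$ forces $d\ge1$, which pays for the $+2$ in $2(\deg
  -- f+k)+2\le4(d+k)$.
  · by_cases hf : π.line i₁ = 0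
    · rw [hj, hf]
      simpa [toReal] using HasL1Proof.zero (e := 4 * (π.degree + k)) (p := system F ρ)
        (by positivity : 0 ≤ stepFactor W k π.size ^ (i.val + 1))
    have hd1 : 1 ≤ π.degree := by
      refine le_trans ?_ (Finset.le_sup (f := fun i => (π.line i).totalDegree)
        (Finset.mem_univ i))
      rw [hj, totalDegree_mul_of_isDomain (X_ne_zero j) hf, totalDegree_X]
      omega
    have hd := hdeg i₁
    obtain ⟨M, hM0, hM, hM'⟩ := exists_hasL1Proof_const_sub_X_sq_mul (F := F)
      (e := 4 * (π.degree + k)) hW (hρ j.pos) j (f := toReal (π.line i₁)) (by omega) (hl1 i₁)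
    have h₁ := ((ih i₁ hi₁).mono (hpow i₁ hi₁)).C_mul hM0
    have hid : -toReal (π.line i) ^ 2 = C M * (-toReal (π.line i₁) ^ 2) +
        (C M - X j ^ 2) * toReal (π.line i₁) ^ 2 := by
      rw [hj]
      simp only [toReal, map_mul, map_X]
      ring
    rw [hid]
    refine (h₁.add hM' (by positivity) (by positivity)).mono ?_
    rw [pow_succ' _ i.val]
    generalize stepFactor W k π.size ^ i.val = K at *
    unfold stepFactor
    generalize (2 : ℝ) ^ π.size = T at *
    generalize domainBound W k = Y at *
    have hT16 : T ^ 4 ≤ T ^ 16 := pow_le_pow_right₀ hT (by norm_num)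
    have hT1 : 1 ≤ T ^ 16 := one_le_pow₀ hT
    have hYY : Y ≤ (k + 1) * Y ^ 2 := by nlinarith
    have hkY' : k * Y ^ 2 ≤ (k + 1) * Y ^ 2 := by nlinarith
    generalize (k + 1) * Y ^ 2 = Z at *
    calc M * K + (8 * (k * Y ^ 2) * (T ^ 2) ^ 2 + Y * (T ^ 2) ^ 2)
        = M * 1 * K + (8 * (k * Y ^ 2) * T ^ 4 * 1 + Y * T ^ 4 * 1) := by ring
      _ ≤ (3 * Z) * T ^ 16 * K + (8 * Z * T ^ 16 * K + Z * T ^ 16 * K) := by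
        gcongr
        exact hM.trans (by gcongr)
      _ = 12 * (T ^ 16 * Z * K) := by ring
      _ ≤ 32 * (T ^ 16 * Z * K) := by gcongr; norm_num
      _ = 32 * T ^ 16 * Z * K := by ring

lemma stepFactor_two_pow_le (w k S : ℕ) :
    stepFactor (2 ^ w) k S ≤ 2 ^ (5 + 16 * S + k + 2 * (k + (w + 1) * (k + 2))) := by
  have hk : ((k : ℝ) + 1) ≤ 2 ^ k := by
    have : k + 1 ≤ 2 ^ k := Nat.lt_two_pow_self
    exact_mod_cast this
  have hY : domainBound (2 ^ w) k ≤ 2 ^ (k + (w + 1) * (k + 2)) := by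
    unfold domainBound
    rw [← pow_succ', ← pow_mul, pow_add]
    gcongr
  have hY0 : 0 ≤ domainBound (2 ^ w) k := by unfold domainBound; positivity
  calc stepFactor (2 ^ w) k S
      = 2 ^ 5 * (2 ^ S) ^ 16 * ((k + 1) * domainBound (2 ^ w) k ^ 2) := by
        unfold stepFactor; norm_num
    _ ≤ 2 ^ 5 * (2 ^ S) ^ 16 * (2 ^ k * (2 ^ (k + (w + 1) * (k + 2))) ^ 2) := by gcongr
    _ = _ := by
        simp only [← pow_mul, ← pow_add]
        congr 1
        ring

/-- The simulation with bounds in terms of the number `w` of bits of the domain values. -/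
lemma PCDerivation.hasSoSProof_add_C (π : PCDerivation F ρ r) {w : ℕ}
    (hρ : 0 < n → ∀ i, |(ρ i : ℝ)| + 1 ≤ 2 ^ w) {ε : ℝ} (hε : 0 < ε) {E : ℝ}
    (hE : lgInv ε + ((5 + 16 * π.size + k + 2 * (k + (w + 1) * (k + 2))) * π.size + 3) = E) :
    HasSoSProof (system F ρ) (r + C ε) (4 * (π.degree + k)) (2 ^ E) ∧
      HasSoSProof (system F ρ) (-r + C ε) (4 * (π.degree + k)) (2 ^ E) := by
  have hW : (1 : ℝ) ≤ 2 ^ w := one_le_pow₀ one_le_two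
  have hsq := π.hasL1Proof_neg_line_sq hW hρ (Fin.last π.last)
  have hl1 := l1_toReal_le (π.polyBits_line_le_size (Fin.last π.last))
  have hdeg := π.totalDegree_line_le (Fin.last π.last)
  rw [π.line_last] at hsq hl1 hdeg
  set κ := 5 + 16 * π.size + k + 2 * (k + (w + 1) * (k + 2)) with hκ
  have hK := one_le_stepFactor hW k π.size
  have hB : stepFactor (2 ^ w) k π.size ^ ((Fin.last π.last).val + 1) ≤ (2 : ℝ) ^ (κ * π.size) := by
    rw [pow_mul]
    refine (pow_le_pow_left₀ (by linarith) (stepFactor_two_pow_le w k π.size) _).trans ?_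
    exact pow_le_pow_right₀ (one_le_pow₀ one_le_two) π.last_lt_size
  replace hsq := hsq.mono hB
  have hlg : 0 ≤ lgInv ε := le_max_left _ _
  -- The bracket is at most $5\cdot2^{\kappa S}$; the $+3$ in the exponent supplies a factor $8$.
  have hbound : (2 : ℝ) ^ lgInv ε * (2 ^ (κ * π.size) + ((2 ^ π.size) ^ 2) ^ 2 + 3) ≤ 2 ^ E := by
    have hE' : E = lgInv ε + ((κ * π.size + 3 : ℕ) : ℝ) := by
      rw [← hE, hκ]
      push_cast
      rfl
    rw [hE', Real.rpow_add two_pos, Real.rpow_natCast, pow_add]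
    gcongr
    have h1 : (((2 : ℝ) ^ π.size) ^ 2) ^ 2 ≤ 2 ^ (κ * π.size) := by
      rw [← pow_mul, ← pow_mul]
      refine pow_le_pow_right₀ one_le_two ?_
      rw [mul_comm]
      exact Nat.mul_le_mul_right _ (by omega)
    have h2 : (1 : ℝ) ≤ 2 ^ (κ * π.size) := one_le_pow₀ one_le_two
    linarith
  have hE0 : 0 ≤ E := by rw [← hE]; positivity
  have h1 : (1 : ℝ) ≤ 2 ^ E := Real.one_le_rpow one_le_two hE0
  refine ⟨((hsq.add_C_of_neg_sq (by positivity) hε (by omega) hl1).mono hbound).hasSoSProof h1, ?_⟩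
  rw [← neg_sq r] at hsq
  refine ((hsq.add_C_of_neg_sq (by positivity) hε ?_ ?_).mono hbound).hasSoSProof h1
  · rw [totalDegree_neg]
    omega
  · rwa [l1_neg]

end simulation

end SoSPC

end

/-! ### The theorem: two bounds on the domain values -/

theorem mainTheorem2 :
    ∃ (c : ℕ) (P : MvPolynomial (Fin 3) ℝ) (Q : MvPolynomial (Fin 4) ℝ),
      ∀ (n m k : ℕ) (F : Fin m → MvPolynomial (Fin n) ℝ) (ρ : Fin k → ℚ)
        (r : MvPolynomial (Fin n) ℝ) (π : SoSPC.PCDerivation F ρ r) (ε : ℝ), 0 < ε →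
        (π.DerivesDomain →
          SoSPC.HasSoSProof (SoSPC.system F ρ) (r + MvPolynomial.C ε) (c * (π.degree + k))
            ((2 : ℝ) ^ MvPolynomial.eval ![(k : ℝ), (π.size : ℝ), SoSPC.lgInv ε] P) ∧
          SoSPC.HasSoSProof (SoSPC.system F ρ) (-r + MvPolynomial.C ε) (c * (π.degree + k))
            ((2 : ℝ) ^ MvPolynomial.eval ![(k : ℝ), (π.size : ℝ), SoSPC.lgInv ε] P)) ∧
        (SoSPC.HasSoSProof (SoSPC.system F ρ) (r + MvPolynomial.C ε) (c * (π.degree + k))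
            ((2 : ℝ) ^ MvPolynomial.eval
              ![(k : ℝ), (SoSPC.domainBits ρ : ℝ), (π.size : ℝ), SoSPC.lgInv ε] Q) ∧
          SoSPC.HasSoSProof (SoSPC.system F ρ) (-r + MvPolynomial.C ε) (c * (π.degree + k))
            ((2 : ℝ) ^ MvPolynomial.eval
              ![(k : ℝ), (SoSPC.domainBits ρ : ℝ), (π.size : ℝ), SoSPC.lgInv ε] Q)) := by
  open MvPolynomial in
  refine ⟨4,
    -- Both polynomials are the exponent $E$ of `hasSoSProof_add_C`, with $w=S+2$ and $w=\beta+1$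
    -- respectively.
    X 2 + ((5 + 16 * X 1 + X 0 + 2 * (X 0 + (X 1 + 2 + 1) * (X 0 + 2))) * X 1 + 3),
    X 3 + ((5 + 16 * X 2 + X 0 + 2 * (X 0 + (X 1 + 1 + 1) * (X 0 + 2))) * X 2 + 3),
    fun n m k F ρ r π ε hε => ⟨fun hD => ?_, ?_⟩⟩
  -- For $n=0$ no domain polynomial need occur as a line and the $\rho_i$ are uncontrolled, but then
  -- the multiplication rule cannot occur either; hence the guard $0<n$.
  · refine π.hasSoSProof_add_C (w := π.size + 2) (fun hn i => ?_) hε (by simp)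
    obtain ⟨l, hl⟩ := hD ⟨0, hn⟩
    have h1 := π.polyBits_line_le_size l
    rw [hl] at h1
    have h2 := SoSPC.abs_le_of_polyBits_domainPoly_le h1 i
    have h3 : (1 : ℝ) ≤ 2 ^ π.size := one_le_pow₀ one_le_two
    rw [pow_add]
    linarith
  · refine π.hasSoSProof_add_C (w := SoSPC.domainBits ρ + 1) (fun _ i => ?_) hε (by simp)
    have h1 := SoSPC.abs_le_two_pow_ratBits (ρ i)
    have h2 : SoSPC.ratBits (ρ i) ≤ SoSPC.domainBits ρ :=
      (Finset.le_sup (f := fun i => SoSPC.ratBits (ρ i)) (Finset.mem_univ i)).trans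
        (le_max_left _ _)
    have h3 : (2 : ℝ) ^ SoSPC.ratBits (ρ i) ≤ 2 ^ SoSPC.domainBits ρ :=
      pow_le_pow_right₀ one_le_two h2
    have h4 : (1 : ℝ) ≤ 2 ^ SoSPC.domainBits ρ := one_le_pow₀ one_le_two
    rw [pow_succ]
    linarith
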